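/- Identify $[0,1)$ with the unit circle (topologically identifying $0$ and $1$), with its natural cyclic order, and let $\operatorname{Arc}(s,t)=\min\{|s-t|,\,1-|s-t|\}$. Call a symmetric function $\mathbf d:[0,1)^2\to[0,\infty)$ vanishing on the diagonal a dissimilarity. For a real $n\times n$ matrix $D$ indexed by $[n]=\{0,\dots,n-1\}$ with its standard cyclic order, say that $D$ is strict circular Robinson if it is non-negative, symmetric, zero on the diagonal, and $D(i,k)>\min\{D(j,k),D(k,l)\}$ for all (distinct) cyclically ordered $i,j,k,l\in[n]$. Let $S(D)$ be the set of permutations $\pi$ of $[n]$ such that the matrix with entry $D(i,j)$ at position $(\pi(i),\pi(j))$, for all $i,j$ (i.e. $\Pi D\Pi^{T}$ with $\Pi e_j=e_{\pi(j)}$), is strict circular Robinson. For permutations $\pi_1,\pi_2$ of $[n]$, $n\ge 2$, let $\tau_K(\pi_1,\pi_2)$ be $\binom n2^{-1}$ times the number of pairs $i<j$ which $\pi_1$ and $\pi_2$ put in opposite orders. Let $\operatorname{Dih}_n$ be the group of permutations of $[n]$ generated by $i\mapsto i+1 \bmod n$ and $i\mapsto n-1-i$, and for a set $S$ of permutations of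 $[n]$ put $$\operatorname{diam}(S)=\max_{\pi_1,\pi_2\in S}\ \min_{\rho\in \operatorname{Dih}_n}\tau_K(\rho\circ\pi_1,\pi_2)\qquad(\operatorname{diam}(\emptyset)=0).$$ **Theorem.** There is an absolute constant $C>0$ such that the following holds. Let $0<\ell\le L$ and let $\mathbf d$ be a dissimilarity on $[0,1)$ which is continuous on the circle, strict circular Robinson, i.e. $\mathbf d(y,w)>\min\{\mathbf d(y,x),\mathbf d(y,z)\}$ for all (distinct) cyclically ordered $x,y,z,w\in[0,1)$, and bi-Lipschitz with respect to arc length, i.e. $\ell\operatorname{Arc}(s,t)\le\mathbf d(s,t)\le L\operatorname{Arc}(s,t)$ for all $s,t\in[0,1)$. Let $n\ge2$, let $x_0,\dots,x_{n-1}$ be i.i.d. uniform on $[0,1)$, and let $D=(\mathbf d(x_i,x_j))_{i,j\in[n]}$. Then the random variable $\operatorname{diam}(S(D))$ is integrable and $$\mathbb E\big[\operatorname{diam}(S(D))\big]\ \le\ C\cdot\frac{L+\ell}{\ell}\cdot\frac{\log n}{n}.$$ -/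

import Mathlib

open MeasureTheory ProbabilityTheory

noncomputable section

namespace CircularSeriation

/-- The (strict) cyclic order induced by a linear order: going around the circle in the positive
direction from `a`, one meets `b` strictly before `c`, and the three points are distinct. It is used
for `Fin n` and for the points of `[0, 1)` (the unit circle). -/
def Cyc {α : Type*} [LT α] (a b c : α) : Prop :=
  (a < b ∧ b < c) ∨ (b < c ∧ c < a) ∨ (c < a ∧ a < b)

/-- Four (distinct) points are cyclically ordered: `b`, `c`, `d` appear in this order when the
circle is traversed from `a`. -/
def CycOrdered {α : Type*} [LT α] (a b c d : α) : Prop :=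
  Cyc a b c ∧ Cyc a c d

/-! ### Dissimilarities on the circle `[0, 1)` -/

/-- `d` is a dissimilarity on `[0, 1)`: nonnegative, symmetric, zero on the diagonal. Only the values
of `d` on `[0, 1) × [0, 1)` are ever constrained. -/
structure IsDissimilarity (d : ℝ → ℝ → ℝ) : Prop where
  nonneg : ∀ s ∈ Set.Ico (0 : ℝ) 1, ∀ t ∈ Set.Ico (0 : ℝ) 1, 0 ≤ d s t
  symm : ∀ s ∈ Set.Ico (0 : ℝ) 1, ∀ t ∈ Set.Ico (0 : ℝ) 1, d s t = d t s
  diag : ∀ s ∈ Set.Ico (0 : ℝ) 1, d s s = 0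

/-- Continuity on the circle, that is, on `[0, 1)` with `0` and `1` identified: the 1-periodic
extension of `d` in both variables is continuous on the plane. -/
def IsContinuousOnCircle (d : ℝ → ℝ → ℝ) : Prop :=
  Continuous fun p : ℝ × ℝ => d (Int.fract p.1) (Int.fract p.2)

/-- `d` is strict circular Robinson with respect to the natural cyclic order of `[0, 1)`. -/
def IsStrictCircularRobinson (d : ℝ → ℝ → ℝ) : Prop :=
  ∀ x ∈ Set.Ico (0 : ℝ) 1, ∀ y ∈ Set.Ico (0 : ℝ) 1, ∀ z ∈ Set.Ico (0 : ℝ) 1,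
    ∀ w ∈ Set.Ico (0 : ℝ) 1, CycOrdered x y z w → min (d y x) (d y z) < d y w

/-- Length of the shortest arc between two points of `[0, 1)`. -/
def arc (s t : ℝ) : ℝ := min |s - t| (1 - |s - t|)

/-- The bi-Lipschitz property with constants `ℓ` and `L`. -/
def IsBiLipschitz (ℓ L : ℝ) (d : ℝ → ℝ → ℝ) : Prop :=
  ∀ s ∈ Set.Ico (0 : ℝ) 1, ∀ t ∈ Set.Ico (0 : ℝ) 1,
    ℓ * arc s t ≤ d s t ∧ d s t ≤ L * arc s t

/-- The uniform distribution on `[0, 1)`. -/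
def unif : Measure ℝ := volume.restrict (Set.Ico (0 : ℝ) 1)

/-! ### Matrices, orderings, and the Kendall-tau diameter -/

/-- The dissimilarity matrix of the sample `x`. -/
def dissMatrix {n : ℕ} (d : ℝ → ℝ → ℝ) (x : Fin n → ℝ) : Matrix (Fin n) (Fin n) ℝ :=
  Matrix.of fun i j => d (x i) (x j)

/-- Strict circular Robinson dissimilarity matrices, with respect to the standard cyclic order
of the index set. -/
structure IsStrictCircularRobinsonMatrix {n : ℕ} (D : Matrix (Fin n) (Fin n) ℝ) : Prop where
  nonneg : ∀ i j, 0 ≤ D i j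
  symm : ∀ i j, D i j = D j i
  diag : ∀ i, D i i = 0
  robinson : ∀ i j k l, CycOrdered i j k l → min (D j k) (D k l) < D i k

/-- The solutions of the strict circular seriation problem for `D`: the permutations `π` such that
`Π D Πᵀ` is strict circular Robinson, where `Π` is the permutation matrix with `Π e_j = e_{π j}`.
The entry of `Π D Πᵀ` at `(π i, π j)` is `D i j`: `π i` is the position given to the item `i`. -/
def solutions {n : ℕ} (D : Matrix (Fin n) (Fin n) ℝ) : Set (Equiv.Perm (Fin n)) :=
  {π | IsStrictCircularRobinsonMatrix (Matrix.reindex π π D)}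

/-- The dihedral group, generated by the cyclic shift `i ↦ i + 1 mod n` and the reversal
`i ↦ n - 1 - i`. -/
def dihedral (n : ℕ) : Subgroup (Equiv.Perm (Fin n)) :=
  Subgroup.closure {finRotate n, Fin.revPerm}

/-- The set of discordant pairs of two permutations. -/
def discordant {n : ℕ} (π₁ π₂ : Equiv.Perm (Fin n)) : Finset (Fin n × Fin n) :=
  Finset.univ.filter fun p => p.1 < p.2 ∧
    ((π₁ p.1 < π₁ p.2 ∧ π₂ p.1 > π₂ p.2) ∨ (π₁ p.1 > π₁ p.2 ∧ π₂ p.1 < π₂ p.2))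

/-- The (normalized) Kendall-tau distance. -/
def kendallTau {n : ℕ} (π₁ π₂ : Equiv.Perm (Fin n)) : ℝ :=
  ((discordant π₁ π₂).card : ℝ) / (n.choose 2 : ℝ)

/-- The Kendall-tau diameter modulo dihedral symmetries,
`max_{π₁, π₂ ∈ S} min_{ρ ∈ Dih_n} τ_K(ρ ∘ π₁, π₂)`. All index types are finite, and the diameter of
the empty set is `0`. -/
def diam {n : ℕ} (S : Set (Equiv.Perm (Fin n))) : ℝ :=
  ⨆ π₁ : S, ⨆ π₂ : S, ⨅ ρ : dihedral n,
    kendallTau ((ρ : Equiv.Perm (Fin n)) * (π₁ : Equiv.Perm (Fin n))) (π₂ : Equiv.Perm (Fin n))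

end CircularSeriation

end

/-! Solutions of the strict circular seriation problem are unique up to dihedral symmetries as soon as
the sample is dense at a scale of order `ℓ / (L + ℓ)`; a uniform sample fails to be that dense with
probability at most the claimed rate.

Let `a` and `b` be sample points that are consecutive on the circle, so that `d a b` is small, and
suppose that some solution does not make them neighbours. They cut the order of this solution into two
nonempty arcs, and strict unimodality of the dissimilarities from `a` and from `b` forces one arc to be
closer to `a` than `b` is, and one arc to be closer to `b` than `a` is (`adjacent_or_near`). If the two
arcs differ, every sample point is close to `a` or to `b`. If they coincide, there is a point `c` close
to both, and the Robinson property of `d` on the circle, along the arc from `b` through `c` to `a`,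
again shows that every sample point is close to `a` or to `b` (`near_of_no_point_between`). By the
bi-Lipschitz property, no sample point is then near the antipode of `a`, against density
(`adjacent_of_dense`). Hence every solution maps the `n`-cycle of sorted sample points onto the
`n`-cycle of positions, that is, it is determined up to an element of the dihedral group
(`mem_dihedral_of_adjacent`), and the diameter is zero.

For the density, divide the circle into `N` bins with `N` of order `(L + ℓ) / ℓ`. All are hit except
with probability at most `N * exp (-n / N)`. This is at most the claimed rate if `n` is large compared
with `N * log n`, and otherwise the trivial bound `1` on the diameter suffices. -/

open MeasureTheory ProbabilityTheory

namespace CircularSeriation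

/-! ### Cyclic order -/

theorem Cyc.rotate {α : Type*} [LT α] {a b c : α} (h : Cyc a b c) : Cyc b c a := by
  rcases h with h | h | h
  · exact Or.inr (Or.inr h)
  · exact Or.inl h
  · exact Or.inr (Or.inl h)

theorem cyc_or_cyc {α : Type*} [LinearOrder α] {a b c : α} (hab : a ≠ b) (hac : a ≠ c)
    (hbc : b ≠ c) : Cyc a b c ∨ Cyc b a c := by
  unfold Cyc
  rcases lt_or_gt_of_ne hab with h₁ | h₁ <;> rcases lt_or_gt_of_ne hac with h₂ | h₂ <;>
    rcases lt_or_gt_of_ne hbc with h₃ | h₃ <;> simp [h₁, h₂, h₃]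

/-- If `b` comes before `c`, and `c` before `e`, on the way around from `a`, then `b`, `c`, `e`
are themselves in cyclic order. -/
theorem Cyc.trans {α : Type*} [Preorder α] {a b c e : α} (h₁ : Cyc a b c) (h₂ : Cyc a c e) :
    Cyc b c e := by
  unfold Cyc at *
  grind

theorem cyc_add_one {m : ℕ} {p q : Fin (m + 1)} (h : p ≠ q) (h' : p + 1 ≠ q) :
    Cyc p (p + 1) q := by
  have hv := Fin.val_add_one p
  unfold Cyc
  simp only [Fin.lt_def, Fin.ext_iff, ne_eq, Fin.val_last] at *
  split_ifs at hv <;> omega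

/-! ### Permutations that preserve cyclic adjacency are dihedral -/

theorem finRotate_pow_apply {m : ℕ} (k : ℕ) (i : Fin (m + 1)) :
    (finRotate (m + 1) ^ k) i = i + k • (1 : Fin (m + 1)) := by
  induction k with
  | zero => simp
  | succ k ih => rw [pow_succ', Equiv.Perm.mul_apply, ih, finRotate_apply, succ_nsmul, add_assoc]

open Fin.CommRing in
theorem val_nsmul_one {m : ℕ} (i : Fin (m + 1)) : (i : ℕ) • (1 : Fin (m + 1)) = i := by
  rw [nsmul_one, Fin.cast_val_eq_self]

theorem mem_dihedral_of_map_add_one {m : ℕ} (τ : Equiv.Perm (Fin (m + 1)))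
    (h : ∀ i, τ (i + 1) = τ i + 1) : τ ∈ dihedral (m + 1) := by
  have key : ∀ k : ℕ, τ (k • (1 : Fin (m + 1))) = τ 0 + k • (1 : Fin (m + 1)) := by
    intro k
    induction k with
    | zero => simp
    | succ k ih => rw [succ_nsmul, h, ih, add_assoc]
  have : τ = finRotate (m + 1) ^ (τ 0 : ℕ) := by
    ext1 i
    have := key i
    rw [val_nsmul_one] at this
    rw [finRotate_pow_apply, val_nsmul_one, this]
    exact add_comm _ _
  rw [this]
  exact Subgroup.pow_mem _ (Subgroup.subset_closure (by simp)) _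

/-- A permutation that maps neighbours to neighbours keeps the direction of its first step: to
reverse it, it would have to revisit a value. -/
theorem map_add_one_of_adjacent {m : ℕ} (τ : Equiv.Perm (Fin (m + 1)))
    (h : ∀ i, τ (i + 1) = τ i + 1 ∨ τ i = τ (i + 1) + 1) (h₀ : τ (0 + 1) = τ 0 + 1)
    (i : Fin (m + 1)) : τ (i + 1) = τ i + 1 := by
  have key : ∀ k : ℕ, τ (k • (1 : Fin (m + 1)) + 1) = τ (k • (1 : Fin (m + 1))) + 1 := by
    intro k
    induction k with
    | zero => simpa using h₀
    | succ k ih =>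
      rw [succ_nsmul]
      set j : Fin (m + 1) := k • (1 : Fin (m + 1))
      rcases h (j + 1) with h' | h'
      · exact h'
      · -- The walk may only turn back to `τ j` when `j + 2 = j`, and then both steps coincide.
        have e : j + 1 + 1 = j := τ.injective (add_right_cancel (h'.symm.trans ih))
        have e₂ : (1 : Fin (m + 1)) + 1 = 0 := by
          rw [add_assoc] at e
          exact add_eq_left.mp e
        rw [e, ih, add_assoc, e₂, add_zero]
  have := key i
  rwa [val_nsmul_one] at this

theorem rev_add_one {m : ℕ} (j : Fin (m + 1)) : Fin.rev (j + 1) + 1 = Fin.rev j := by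
  have h₁ := Fin.val_add_one j
  have h₂ := Fin.val_add_one (Fin.rev (j + 1))
  simp only [Fin.ext_iff, Fin.val_rev, Fin.val_last] at *
  split_ifs at h₁ h₂ <;> omega

/-- The automorphism group of the `n`-cycle is dihedral. -/
theorem mem_dihedral_of_adjacent {m : ℕ} (τ : Equiv.Perm (Fin (m + 1)))
    (h : ∀ i, τ (i + 1) = τ i + 1 ∨ τ i = τ (i + 1) + 1) : τ ∈ dihedral (m + 1) := by
  rcases h 0 with h₀ | h₀
  · exact mem_dihedral_of_map_add_one τ (map_add_one_of_adjacent τ h h₀)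
  · have hr : Fin.revPerm * τ ∈ dihedral (m + 1) := by
      refine mem_dihedral_of_map_add_one _ (map_add_one_of_adjacent _ ?_ ?_)
      · intro i
        simp only [Equiv.Perm.mul_apply, Fin.revPerm_apply]
        rcases h i with hi | hi
        · right; rw [hi, rev_add_one]
        · left; rw [hi, rev_add_one]
      · simp only [Equiv.Perm.mul_apply, Fin.revPerm_apply]
        rw [h₀, rev_add_one]
    exact (Subgroup.mul_mem_cancel_left _ (Subgroup.subset_closure (by simp))).1 hr

/-! ### The Kendall-tau diameter -/

theorem kendallTau_nonneg {n : ℕ} (π₁ π₂ : Equiv.Perm (Fin n)) : 0 ≤ kendallTau π₁ π₂ := by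
  unfold kendallTau; positivity

theorem kendallTau_self {n : ℕ} (π : Equiv.Perm (Fin n)) : kendallTau π π = 0 := by
  have : discordant π π = ∅ := by
    refine Finset.filter_eq_empty_iff.2 fun p _ hp => ?_
    rcases hp.2 with h | h <;> exact lt_asymm h.1 h.2
  simp [kendallTau, this]

theorem card_discordant_le {n : ℕ} (π₁ π₂ : Equiv.Perm (Fin n)) :
    (discordant π₁ π₂).card ≤ n.choose 2 := by
  have hc : (Finset.powersetCard 2 (Finset.univ : Finset (Fin n))).card = n.choose 2 := by simp
  rw [← hc]
  refine Finset.card_le_card_of_injOn (fun p => {p.1, p.2}) ?_ ?_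
  · intro p hp
    have hp' := (Finset.mem_filter.1 (Finset.mem_coe.1 hp)).2.1
    simp [Finset.mem_powersetCard, Finset.card_pair hp'.ne]
  · intro p hp q hq h
    have hp' := (Finset.mem_filter.1 (Finset.mem_coe.1 hp)).2.1
    have hq' := (Finset.mem_filter.1 (Finset.mem_coe.1 hq)).2.1
    have h' : s(p.1, p.2) = s(q.1, q.2) := by
      have := congrArg (fun s : Finset (Fin n) => (s : Set (Fin n))) h
      simp only [Finset.coe_pair] at this
      rw [Set.pair_eq_pair_iff] at this
      exact Sym2.eq_iff.2 this
    rcases Sym2.eq_iff.1 h' with h | h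
    · exact Prod.ext h.1 h.2
    · rw [h.1, h.2] at hp'
      exact absurd hp' hq'.asymm

theorem kendallTau_le_one {n : ℕ} (π₁ π₂ : Equiv.Perm (Fin n)) : kendallTau π₁ π₂ ≤ 1 :=
  div_le_one_of_le₀ (by exact_mod_cast card_discordant_le π₁ π₂) (by positivity)

theorem bddBelow_kendallTau {n : ℕ} (π₁ π₂ : Equiv.Perm (Fin n)) :
    BddBelow (Set.range fun ρ : dihedral n => kendallTau ((ρ : Equiv.Perm (Fin n)) * π₁) π₂) :=
  ⟨0, by rintro _ ⟨ρ, rfl⟩; exact kendallTau_nonneg _ _⟩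

theorem diam_nonneg {n : ℕ} (S : Set (Equiv.Perm (Fin n))) : 0 ≤ diam S :=
  Real.iSup_nonneg fun _ => Real.iSup_nonneg fun _ => Real.iInf_nonneg fun _ =>
    kendallTau_nonneg _ _

theorem diam_le_one {n : ℕ} (S : Set (Equiv.Perm (Fin n))) : diam S ≤ 1 :=
  Real.iSup_le (fun _ => Real.iSup_le (fun _ =>
    (ciInf_le (bddBelow_kendallTau _ _) 1).trans (kendallTau_le_one _ _)) zero_le_one) zero_le_one

/-- The diameter vanishes when `S` lies in a single coset of the dihedral group. -/
theorem diam_eq_zero {n : ℕ} {S : Set (Equiv.Perm (Fin n))}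
    (h : ∀ π₁ ∈ S, ∀ π₂ ∈ S, π₂ * π₁⁻¹ ∈ dihedral n) : diam S = 0 := by
  refine le_antisymm (Real.iSup_le (fun π₁ => Real.iSup_le (fun π₂ => ?_) le_rfl) le_rfl)
    (diam_nonneg S)
  refine (ciInf_le (bddBelow_kendallTau _ _) ⟨_, h π₁ π₁.2 π₂ π₂.2⟩).trans ?_
  simp [kendallTau_self]

/-! ### Neighbours on the circle are neighbours in every solution -/

/-- Let `c` and `w` lie outside the positive arc from `a` to `b`, with `c` closer to both `a` and `b`
than these are to each other. Then `w` is within `d a b` of `a` or of `b`: the point `w` lies between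
`b` and `c`, or between `c` and `a`, and the strict Robinson property at `b`, respectively `a`, shows
that it is closer to that endpoint than `c` is. -/
theorem near_of_no_point_between {d : ℝ → ℝ → ℝ} (hd : IsDissimilarity d)
    (hR : IsStrictCircularRobinson d) {a b c w : ℝ} (ha : a ∈ Set.Ico (0 : ℝ) 1)
    (hb : b ∈ Set.Ico (0 : ℝ) 1) (hc : c ∈ Set.Ico (0 : ℝ) 1) (hw : w ∈ Set.Ico (0 : ℝ) 1)
    (hcab : ¬ Cyc a c b) (hwab : ¬ Cyc a w b) (hac : d a c < d a b) (hbc : d b c < d a b) :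
    d a w ≤ d a b ∨ d b w ≤ d a b := by
  have hsymm := hd.symm a ha b hb
  have hab0 := hd.nonneg a ha b hb
  by_cases hwa : w = a
  · left; rw [hwa, hd.diag a ha]; exact hab0
  by_cases hwb : w = b
  · right; rw [hwb, hd.diag b hb]; exact hab0
  by_cases hwc : w = c
  · left; rw [hwc]; exact hac.le
  have hab : a ≠ b := by
    rintro rfl
    have := hd.nonneg a ha c hc
    rw [hd.diag a ha] at hac
    linarith
  have hca : c ≠ a := by
    rintro rfl
    linarith
  have hcb : c ≠ b := by
    rintro rfl
    exact lt_irrefl _ hac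
  have h₁ : Cyc a b c := (cyc_or_cyc hca hcb hab).elim (fun h => h.rotate) fun h => (hcab h).elim
  have h₂ : Cyc a b w := (cyc_or_cyc hwa hwb hab).elim (fun h => h.rotate) fun h => (hwab h).elim
  rcases cyc_or_cyc (Ne.symm hwb) (Ne.symm hcb) hwc with h | h
  · have := hR a ha b hb w hw c hc ⟨h₂, ?_⟩
    · right
      rcases min_lt_iff.1 this with h | h <;> linarith
    · exact (h.trans h₁.rotate).rotate.rotate
  · have := hR w hw a ha b hb c hc ⟨h₂.rotate.rotate, h⟩
    left
    rcases min_lt_iff.1 this with h | h <;> linarith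

/-- In a solution where the items `a` and `b` are not neighbours, they cut the cyclic order into two
nonempty arcs. Seen from `a`, one of these arcs lies entirely closer than `b`; seen from `b`, one of
them lies entirely closer than `a`. If it is the same arc, any item in it is close to both; if not,
every item is close to one of the two. -/
theorem adjacent_or_near {m : ℕ} {D : Matrix (Fin (m + 1)) (Fin (m + 1)) ℝ}
    {π : Equiv.Perm (Fin (m + 1))} (hπ : π ∈ solutions D) {a b : Fin (m + 1)} (hab : a ≠ b) :
    π b = π a + 1 ∨ π a = π b + 1 ∨ (∀ w, w ≠ a → w ≠ b → D a w < D a b ∨ D b w < D a b) ∨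
      ∃ c, D a c < D a b ∧ D b c < D a b := by
  by_contra! hcon
  obtain ⟨h₁, h₂, ⟨w, hwa, hwb, hw₁, hw₂⟩, hc⟩ := hcon
  have hD : IsStrictCircularRobinsonMatrix (Matrix.reindex π π D) := hπ
  have hsymm : ∀ i j, D i j = D j i := fun i j => by
    simpa using hD.symm (π i) (π j)
  have hpq : π a ≠ π b := π.injective.ne hab
  -- From `a`, and from `b`, one of the two arcs is entirely closer than the other endpoint.
  have key : ∀ r s : Fin (m + 1), Cyc (π a) (π r) (π b) → Cyc (π b) (π s) (π a) →
      (D a r < D a b ∨ D a s < D a b) ∧ (D b r < D a b ∨ D b s < D a b) := by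
    intro r s hr hs
    have e₁ := hD.robinson (π b) (π s) (π a) (π r) ⟨hs, hr.rotate.rotate⟩
    have e₂ := hD.robinson (π a) (π r) (π b) (π s) ⟨hr, hs.rotate.rotate⟩
    simp only [Matrix.reindex_apply, Matrix.submatrix_apply, Equiv.symm_apply_apply,
      min_lt_iff] at e₁ e₂
    rw [hsymm b a, hsymm s a] at e₁
    rw [hsymm r b] at e₂
    exact ⟨e₁.symm, e₂⟩
  have hr₀ : Cyc (π a) (π (π.symm (π a + 1))) (π b) := by
    rw [Equiv.apply_symm_apply]; exact cyc_add_one hpq (Ne.symm h₁)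
  have hs₀ : Cyc (π b) (π (π.symm (π b + 1))) (π a) := by
    rw [Equiv.apply_symm_apply]; exact cyc_add_one hpq.symm (Ne.symm h₂)
  rcases cyc_or_cyc (π.injective.ne hwa) (π.injective.ne hwb) hpq with h | h
  · have := key _ w hr₀ h.rotate.rotate
    grind
  · have := key w _ h hs₀
    grind

/-! ### Dense samples on the circle -/

theorem arc_le_add {a b c : ℝ} (ha : a ∈ Set.Ico (0 : ℝ) 1) (hb : b ∈ Set.Ico (0 : ℝ) 1)
    (hc : c ∈ Set.Ico (0 : ℝ) 1) : arc a c ≤ arc a b + arc b c := by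
  obtain ⟨ha₀, ha₁⟩ := ha
  obtain ⟨hb₀, hb₁⟩ := hb
  obtain ⟨hc₀, hc₁⟩ := hc
  unfold arc
  rcases abs_cases (a - b) with ⟨h₁, _⟩ | ⟨h₁, _⟩ <;>
    rcases abs_cases (b - c) with ⟨h₂, _⟩ | ⟨h₂, _⟩ <;>
    rcases abs_cases (a - c) with ⟨h₃, _⟩ | ⟨h₃, _⟩ <;>
    rw [h₁, h₂, h₃] <;>
    rcases min_cases (a - b) (1 - (a - b)) with ⟨h₄, _⟩ | ⟨h₄, _⟩ <;>
    rcases min_cases (-(a - b)) (1 - -(a - b)) with ⟨h₅, _⟩ | ⟨h₅, _⟩ <;>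
    rcases min_cases (b - c) (1 - (b - c)) with ⟨h₆, _⟩ | ⟨h₆, _⟩ <;>
    rcases min_cases (-(b - c)) (1 - -(b - c)) with ⟨h₇, _⟩ | ⟨h₇, _⟩ <;>
    simp only [h₄, h₅, h₆, h₇, min_le_iff] <;>
    first
      | (left; linarith)
      | (right; linarith)

/-- A `δ`-dense family has a point within `δ` of the antipode of `a`. -/
theorem exists_antipode {ι : Type*} {x : ι → ℝ} {δ : ℝ}
    (hδ : ∀ t ∈ Set.Ico (0 : ℝ) 1, ∃ j, |x j - t| < δ) {a : ℝ} (ha : a ∈ Set.Ico (0 : ℝ) 1) :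
    ∃ j, 1 / 2 - δ < arc a (x j) := by
  obtain ⟨ha₀, ha₁⟩ := ha
  rcases lt_or_ge a (1 / 2) with h | h
  · obtain ⟨j, hj⟩ := hδ (a + 1 / 2) ⟨by linarith, by linarith⟩
    rw [abs_lt] at hj
    refine ⟨j, lt_min ?_ ?_⟩
    · rw [abs_sub_comm]; exact lt_of_lt_of_le (by linarith) (le_abs_self _)
    · have : |a - x j| < 1 / 2 + δ := abs_lt.2 ⟨by linarith, by linarith⟩
      linarith
  · obtain ⟨j, hj⟩ := hδ (a - 1 / 2) ⟨by linarith, by linarith⟩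
    rw [abs_lt] at hj
    refine ⟨j, lt_min ?_ ?_⟩
    · exact lt_of_lt_of_le (by linarith) (le_abs_self _)
    · have : |a - x j| < 1 / 2 + δ := abs_lt.2 ⟨by linarith, by linarith⟩
      linarith

/-- Nothing in a sorted family lies strictly between two cyclically consecutive terms. Ties are
allowed, since `Cyc` is strict. -/
theorem not_cyc_of_monotone {m : ℕ} {y : Fin (m + 1) → ℝ} (hy : Monotone y) (i j : Fin (m + 1)) :
    ¬ Cyc (y i) (y j) (y (i + 1)) := by
  have hv := Fin.val_add_one i
  by_cases hi : i = Fin.last m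
  · have h0 : i + 1 = 0 := by rw [hi, Fin.last_add_one]
    have h₁ : y j ≤ y i := hy (by rw [hi]; exact Fin.le_last j)
    have h₂ : y (i + 1) ≤ y j := hy (by rw [h0]; exact Fin.zero_le j)
    rintro (h | h | h) <;> linarith [h.1, h.2]
  · rw [if_neg hi] at hv
    have h₁ : y i ≤ y (i + 1) := hy (by rw [Fin.le_def]; omega)
    have h₂ : y j ≤ y i ∨ y (i + 1) ≤ y j := by
      rcases le_or_gt j i with h | h
      · exact Or.inl (hy h)
      · exact Or.inr (hy (by rw [Fin.lt_def] at h; rw [Fin.le_def]; omega))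
    rintro (h | h | h) <;> rcases h₂ with h₂ | h₂ <;> linarith [h.1, h.2]

/-- In a sorted `δ`-dense family, cyclically consecutive points are at most `3 * δ` apart. The pairs
that do not wrap around satisfy this with `2 * δ`. -/
theorem arc_consecutive_le {m : ℕ} {y : Fin (m + 1) → ℝ} (hy : Monotone y)
    (hy₁ : ∀ i, y i ∈ Set.Ico (0 : ℝ) 1) {δ : ℝ} (hδ₀ : 0 < δ)
    (hδ : ∀ t ∈ Set.Ico (0 : ℝ) 1, ∃ j, |y j - t| < δ) (i : Fin (m + 1)) :
    arc (y i) (y (i + 1)) ≤ 3 * δ := by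
  have hv := Fin.val_add_one i
  obtain ⟨hi₀, hi₁⟩ := hy₁ i
  obtain ⟨hs₀, hs₁⟩ := hy₁ (i + 1)
  by_cases hi : i = Fin.last m
  · have h0 : i + 1 = 0 := by rw [hi, Fin.last_add_one]
    refine (min_le_right _ _).trans ?_
    have h₁ : y (i + 1) < δ := by
      obtain ⟨j, hj⟩ := hδ 0 ⟨le_rfl, one_pos⟩
      have : y (i + 1) ≤ y j := hy (by rw [h0]; exact Fin.zero_le j)
      linarith [(abs_lt.1 hj).2]
    have h₂ : 1 - 2 * δ < y i := by
      rcases le_or_gt δ 1 with h | h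
      · obtain ⟨j, hj⟩ := hδ (1 - δ) ⟨by linarith, by linarith⟩
        have : y j ≤ y i := hy (by rw [hi]; exact Fin.le_last j)
        linarith [(abs_lt.1 hj).1]
      · linarith
    linarith [le_abs_self (y i - y (i + 1))]
  · rw [if_neg hi] at hv
    refine (min_le_left _ _).trans ?_
    have h₁ : y i ≤ y (i + 1) := hy (by rw [Fin.le_def]; omega)
    rw [abs_sub_comm, abs_of_nonneg (by linarith)]
    rcases lt_or_ge (y i + δ) 1 with h | h
    · obtain ⟨j, hj⟩ := hδ (y i + δ) ⟨by linarith, h⟩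
      rw [abs_lt] at hj
      have hij : i < j := by
        by_contra! hc
        linarith [hy hc]
      have : y (i + 1) ≤ y j := hy (by rw [Fin.lt_def] at hij; rw [Fin.le_def]; omega)
      linarith
    · linarith

/-! ### All solutions agree for a dense sample -/

/-- Sample points that are consecutive on the circle are neighbours in every solution. Otherwise all
sample points would be within `L * (3 * δ)` of one of the two, in the dissimilarity `d`, whereas a
point near the antipode is at arc distance more than `1 / 2 - 4 * δ` from both. -/
theorem adjacent_of_dense {d : ℝ → ℝ → ℝ} {ℓ L : ℝ} (hd : IsDissimilarity d)
    (hR : IsStrictCircularRobinson d) (hℓ : 0 < ℓ) (hL : ℓ ≤ L) (hB : IsBiLipschitz ℓ L d)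
    {m : ℕ} (hm : m ≠ 0) {x : Fin (m + 1) → ℝ} (hx : ∀ i, x i ∈ Set.Ico (0 : ℝ) 1) {δ : ℝ}
    (hδ₀ : 0 < δ) (hδℓ : δ * (8 * (L + ℓ)) ≤ ℓ)
    (hδ : ∀ t ∈ Set.Ico (0 : ℝ) 1, ∃ j, |x j - t| < δ) {π : Equiv.Perm (Fin (m + 1))}
    (hπ : π ∈ solutions (dissMatrix d x)) (i : Fin (m + 1)) :
    π (Tuple.sort x (i + 1)) = π (Tuple.sort x i) + 1 ∨
      π (Tuple.sort x i) = π (Tuple.sort x (i + 1)) + 1 := by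
  have hmono := Tuple.monotone_sort x
  have hgap : arc (x (Tuple.sort x i)) (x (Tuple.sort x (i + 1))) ≤ 3 * δ := by
    refine arc_consecutive_le hmono (fun j => hx _) hδ₀ (fun t ht => ?_) i
    obtain ⟨j, hj⟩ := hδ t ht
    exact ⟨(Tuple.sort x).symm j, by simpa using hj⟩
  have hno : ∀ w, ¬ Cyc (x (Tuple.sort x i)) (x w) (x (Tuple.sort x (i + 1))) := by
    intro w
    simpa using not_cyc_of_monotone hmono i ((Tuple.sort x).symm w)
  have hne : Tuple.sort x i ≠ Tuple.sort x (i + 1) := by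
    refine (Tuple.sort x).injective.ne fun h => hm ?_
    have := Fin.val_add_one i
    rw [← h] at this
    split_ifs at this with hi
    · rw [hi, Fin.val_last] at this; exact this
    · omega
  set a := Tuple.sort x i
  set b := Tuple.sort x (i + 1)
  by_contra! hcon
  have hab0 := hd.nonneg _ (hx a) _ (hx b)
  have near : ∀ w, d (x a) (x w) ≤ d (x a) (x b) ∨ d (x b) (x w) ≤ d (x a) (x b) := by
    intro w
    rcases adjacent_or_near hπ hne with h | h | h | ⟨c, hac, hbc⟩
    · exact (hcon.1 h).elim
    · exact (hcon.2 h).elim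
    · by_cases hwa : w = a
      · left; rw [hwa, hd.diag _ (hx a)]; exact hab0
      by_cases hwb : w = b
      · left; rw [hwb]
      exact (h w hwa hwb).imp le_of_lt le_of_lt
    · exact near_of_no_point_between hd hR (hx a) (hx b) (hx c) (hx w) (hno c) (hno w) hac hbc
  obtain ⟨w, hw⟩ := exists_antipode hδ (hx a)
  have htri := arc_le_add (hx a) (hx b) (hx w)
  have hab := (hB _ (hx a) _ (hx b)).2
  have hfar : 1 / 2 - 4 * δ < arc (x a) (x w) ∧ 1 / 2 - 4 * δ < arc (x b) (x w) :=
    ⟨by linarith, by linarith⟩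
  have h₁ : L * arc (x a) (x b) ≤ L * (3 * δ) :=
    mul_le_mul_of_nonneg_left hgap (hℓ.le.trans hL)
  have h₂ : ∀ u, 1 / 2 - 4 * δ < u → L * (3 * δ) < ℓ * u := fun u hu => by
    have := mul_lt_mul_of_pos_left hu hℓ
    have := mul_pos hδ₀ hℓ
    have := mul_pos hδ₀ (hℓ.trans_le hL)
    linarith
  rcases near w with h | h
  · linarith [(hB _ (hx a) _ (hx w)).1, h₂ _ hfar.1]
  · linarith [(hB _ (hx b) _ (hx w)).1, h₂ _ hfar.2]

/-- For a sufficiently dense sample, the seriation problem has a unique solution up to dihedral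
symmetries: each solution, composed with the sorting permutation, preserves adjacency. -/
theorem diam_solutions_eq_zero_of_dense {d : ℝ → ℝ → ℝ} {ℓ L : ℝ} (hd : IsDissimilarity d)
    (hR : IsStrictCircularRobinson d) (hℓ : 0 < ℓ) (hL : ℓ ≤ L) (hB : IsBiLipschitz ℓ L d)
    {n : ℕ} (hn : 2 ≤ n) {x : Fin n → ℝ} (hx : ∀ i, x i ∈ Set.Ico (0 : ℝ) 1) {δ : ℝ}
    (hδ₀ : 0 < δ) (hδℓ : δ * (8 * (L + ℓ)) ≤ ℓ)
    (hδ : ∀ t ∈ Set.Ico (0 : ℝ) 1, ∃ j, |x j - t| < δ) :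
    diam (solutions (dissMatrix d x)) = 0 := by
  obtain ⟨m, rfl⟩ : ∃ m, n = m + 1 := ⟨n - 1, by omega⟩
  have key : ∀ π ∈ solutions (dissMatrix d x), π * Tuple.sort x ∈ dihedral (m + 1) := fun π hπ =>
    mem_dihedral_of_adjacent _ fun i =>
      adjacent_of_dense hd hR hℓ hL hB (by omega) hx hδ₀ hδℓ hδ hπ i
  refine diam_eq_zero fun π₁ h₁ π₂ h₂ => ?_
  have := Subgroup.mul_mem _ (key π₂ h₂) (Subgroup.inv_mem _ (key π₁ h₁))
  simpa [mul_assoc] using this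

/-! ### Measurability and the probability of an empty bin -/

theorem measurable_diam_solutions {n : ℕ} :
    Measurable fun D : Fin n → Fin n → ℝ => diam (solutions (Matrix.of D)) := by
  have hset : Measurable fun D : Fin n → Fin n → ℝ => solutions (Matrix.of D) := by
    refine measurable_set_iff.2 fun π => ?_
    have hE : ∀ i j, Measurable fun D : Fin n → Fin n → ℝ => D (π.symm i) (π.symm j) :=
      fun i j => by fun_prop
    have : ∀ D : Fin n → Fin n → ℝ, π ∈ solutions (Matrix.of D) ↔
        (∀ i j, 0 ≤ D (π.symm i) (π.symm j)) ∧
        (∀ i j, D (π.symm i) (π.symm j) = D (π.symm j) (π.symm i)) ∧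
        (∀ i, D (π.symm i) (π.symm i) = 0) ∧
        ∀ i j k l, CycOrdered i j k l →
          min (D (π.symm j) (π.symm k)) (D (π.symm k) (π.symm l)) < D (π.symm i) (π.symm k) :=
      fun D => ⟨fun h => ⟨h.1, h.2, h.3, h.4⟩, fun h => ⟨h.1, h.2.1, h.2.2.1, h.2.2.2⟩⟩
    simp only [this]
    refine .and (.forall fun i => .forall fun j => ?_) (.and (.forall fun i => .forall fun j => ?_)
      (.and (.forall fun i => ?_) (.forall fun i => .forall fun j => .forall fun k =>
        .forall fun l => .imp measurable_const ?_)))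
    · exact measurableSet_setOfPred.1 (measurableSet_le measurable_const (hE i j))
    · exact measurableSet_setOfPred.1 (measurableSet_eq_fun (hE i j) (hE j i))
    · exact measurableSet_setOfPred.1 (measurableSet_eq_fun (hE i i) measurable_const)
    · exact measurableSet_setOfPred.1 (measurableSet_lt ((hE j k).min (hE k l)) (hE i k))
  exact (measurable_of_finite (diam (n := n))).comp hset

instance : IsProbabilityMeasure unif := ⟨by simp [unif]⟩

theorem unif_real_Ico {a b : ℝ} (ha : 0 ≤ a) (hab : a ≤ b) (hb : b ≤ 1) :
    unif.real (Set.Ico a b) = b - a := by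
  rw [unif, measureReal_restrict_apply measurableSet_Ico,
    Set.inter_eq_left.2 (Set.Ico_subset_Ico ha hb), Real.volume_real_Ico_of_le hab]

theorem ae_mem_Ico {Ω : Type*} [MeasurableSpace Ω] {P : Measure Ω} {n : ℕ}
    {X : Fin n → Ω → ℝ} (hX : ∀ i, HasLaw (X i) unif P) :
    ∀ᵐ ω ∂P, ∀ i, X i ω ∈ Set.Ico (0 : ℝ) 1 := by
  refine ae_all_iff.2 fun i => ?_
  refine ((hX i).ae_iff (p := fun t => t ∈ Set.Ico (0 : ℝ) 1) ?_).2 ?_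
  · exact measurableSet_setOfPred.1 measurableSet_Ico
  · exact ae_restrict_mem measurableSet_Ico

theorem measureReal_forall_notMem_Ico {Ω : Type*} [MeasurableSpace Ω] {P : Measure Ω} {n : ℕ}
    {X : Fin n → Ω → ℝ} (hind : iIndepFun X P) (hX : ∀ i, HasLaw (X i) unif P)
    {a b : ℝ} (ha : 0 ≤ a) (hab : a ≤ b) (hb : b ≤ 1) :
    P.real {ω | ∀ i, X i ω ∉ Set.Ico a b} = (1 - (b - a)) ^ n := by
  have h := hind.measure_inter_preimage_eq_mul Finset.univ (sets := fun _ => (Set.Ico a b)ᶜ)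
    fun _ _ => measurableSet_Ico.compl
  have e : {ω | ∀ i, X i ω ∉ Set.Ico a b} = ⋂ i ∈ Finset.univ, X i ⁻¹' (Set.Ico a b)ᶜ := by
    ext; simp
  have h' : ∀ i, P (X i ⁻¹' (Set.Ico a b)ᶜ) = unif (Set.Ico a b)ᶜ := fun i =>
    (hX i).measure_eq (p := fun t => t ∈ (Set.Ico a b)ᶜ) measurableSet_Ico.compl
  rw [e, measureReal_def, h]
  simp only [h', Finset.prod_const, Finset.card_univ, Fintype.card_fin, ENNReal.toReal_pow]
  rw [← measureReal_def, measureReal_compl measurableSet_Ico, unif_real_Ico ha hab hb]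
  simp

/-- A union bound for the event that one of `N` equal bins contains no sample point. -/
theorem measureReal_exists_empty_bin_le {Ω : Type*} [MeasurableSpace Ω] {P : Measure Ω}
    [IsProbabilityMeasure P] {n : ℕ} {X : Fin n → Ω → ℝ} (hind : iIndepFun X P) (hX : ∀ i, HasLaw (X i) unif P)
    {N : ℕ} (hN : 0 < N) :
    P.real {ω | ∃ k < N, ∀ i, X i ω ∉ Set.Ico ((k : ℝ) / N) ((k + 1) / N)} ≤
      N * Real.exp (-(n / N)) := by
  have hN' : (0 : ℝ) < N := by exact_mod_cast hN
  have e : {ω | ∃ k < N, ∀ i, X i ω ∉ Set.Ico ((k : ℝ) / N) ((k + 1) / N)} =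
      ⋃ k ∈ Finset.range N, {ω | ∀ i, X i ω ∉ Set.Ico ((k : ℝ) / N) ((k + 1) / N)} := by
    ext; simp
  rw [e]
  refine (measureReal_biUnion_finset_le _ _).trans ?_
  have h : ∀ k ∈ Finset.range N,
      P.real {ω | ∀ i, X i ω ∉ Set.Ico ((k : ℝ) / N) ((k + 1) / N)} ≤ Real.exp (-(n / N)) := by
    intro k hk
    have hk' : (k : ℝ) + 1 ≤ N := by exact_mod_cast Finset.mem_range.1 hk
    rw [measureReal_forall_notMem_Ico hind hX (by positivity) (by gcongr; simp)
      ((div_le_one hN').2 hk')]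
    have hw : ((k : ℝ) + 1) / N - k / N = 1 / N := by ring
    have hle : 1 - (1 : ℝ) / N ≤ Real.exp (-(1 / N)) := by
      linarith [Real.add_one_le_exp (-(1 / (N : ℝ)))]
    have h0 : 0 ≤ 1 - (1 : ℝ) / N := by
      rw [sub_nonneg, div_le_one hN']; exact_mod_cast hN
    rw [hw]
    refine (pow_le_pow_left₀ h0 hle n).trans_eq ?_
    rw [← Real.exp_nat_mul]
    congr 1; ring
  refine (Finset.sum_le_sum h).trans_eq ?_
  simp

theorem dense_of_forall_bin {ι : Type*} {x : ι → ℝ} {N : ℕ} (hN : 0 < N)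
    (h : ∀ k < N, ∃ i, x i ∈ Set.Ico ((k : ℝ) / N) ((k + 1) / N)) :
    ∀ t ∈ Set.Ico (0 : ℝ) 1, ∃ j, |x j - t| < 1 / N := by
  intro t ht
  have hN' : (0 : ℝ) < N := by exact_mod_cast hN
  have h0 : 0 ≤ t * N := mul_nonneg ht.1 hN'.le
  have hk : ⌊t * N⌋₊ < N := (Nat.floor_lt h0).2 (by nlinarith [ht.2])
  obtain ⟨j, hj₁, hj₂⟩ := h _ hk
  have h₁ : (⌊t * N⌋₊ : ℝ) / N ≤ t := (div_le_iff₀ hN').2 (Nat.floor_le h0)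
  have h₂ : t < ((⌊t * N⌋₊ : ℝ) + 1) / N := (lt_div_iff₀ hN').2 (Nat.lt_floor_add_one _)
  rw [add_div] at hj₂ h₂
  exact ⟨j, abs_lt.2 ⟨by linarith, by linarith⟩⟩

/-- The diameter is bounded, and measurable in the sample because `d` is continuous. -/
theorem integrable_diam_solutions {Ω : Type*} [MeasurableSpace Ω] {P : Measure Ω}
    [IsProbabilityMeasure P] {n : ℕ} {X : Fin n → Ω → ℝ} {d : ℝ → ℝ → ℝ} (hd : IsContinuousOnCircle d)
    (hX : ∀ i, HasLaw (X i) unif P) :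
    Integrable (fun ω => diam (solutions (dissMatrix d fun i => X i ω))) P := by
  have hm : AEMeasurable (fun ω => diam (solutions (Matrix.of fun i j =>
      d (Int.fract (X i ω)) (Int.fract (X j ω))))) P := by
    refine measurable_diam_solutions.comp_aemeasurable ?_
    refine aemeasurable_pi_lambda _ fun i => aemeasurable_pi_lambda _ fun j => ?_
    exact Continuous.measurable hd |>.comp_aemeasurable
      ((hX i).aemeasurable.prodMk (hX j).aemeasurable)
  have hae : AEMeasurable (fun ω => diam (solutions (dissMatrix d fun i => X i ω))) P := by
    refine hm.congr ?_
    filter_upwards [ae_mem_Ico hX] with ω hω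
    simp only [Int.fract_eq_self.2 (hω _), dissMatrix]
  refine Integrable.of_bound hae.aestronglyMeasurable 1 (.of_forall fun ω => ?_)
  rw [Real.norm_of_nonneg (diam_nonneg _)]
  exact diam_le_one _

/-! ### The bound on the expectation -/

/-- With probability at least `1 - N * exp (-n / N)` all `N` bins are hit and the diameter vanishes;
it never exceeds `1`. -/
theorem integral_diam_le {d : ℝ → ℝ → ℝ} {ℓ L : ℝ} (hd : IsDissimilarity d)
    (hcont : IsContinuousOnCircle d) (hR : IsStrictCircularRobinson d) (hℓ : 0 < ℓ) (hL : ℓ ≤ L)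
    (hB : IsBiLipschitz ℓ L d) {n : ℕ} (hn : 2 ≤ n) {Ω : Type*} [MeasurableSpace Ω]
    {P : Measure Ω} [IsProbabilityMeasure P] {X : Fin n → Ω → ℝ} (hind : iIndepFun X P)
    (hX : ∀ i, HasLaw (X i) unif P) {N : ℕ} (hN₀ : 0 < N) (hN : 8 * ((L + ℓ) / ℓ) ≤ N) :
    ∫ ω, diam (solutions (dissMatrix d fun i => X i ω)) ∂P ≤ N * Real.exp (-(n / N)) := by
  -- The `X i` are only almost everywhere measurable, so the event is replaced by a measurable hull.
  set bad : Set Ω := {ω | ∃ k < N, ∀ i, X i ω ∉ Set.Ico ((k : ℝ) / N) ((k + 1) / N)}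
  have hN' : (0 : ℝ) < N := by exact_mod_cast hN₀
  have hmeas : MeasurableSet (toMeasurable P bad) := measurableSet_toMeasurable P bad
  have hle : ∀ᵐ ω ∂P, diam (solutions (dissMatrix d fun i => X i ω)) ≤
      (toMeasurable P bad).indicator (fun _ => (1 : ℝ)) ω := by
    filter_upwards [ae_mem_Ico hX] with ω hω
    by_cases h : ω ∈ bad
    · rw [Set.indicator_of_mem (subset_toMeasurable P bad h)]
      exact diam_le_one _
    · refine le_of_eq_of_le ?_ (Set.indicator_nonneg (fun _ _ => zero_le_one) ω)
      have h' : ∀ k < N, ∃ i, X i ω ∈ Set.Ico ((k : ℝ) / N) ((k + 1) / N) := by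
        intro k hk
        by_contra! hc
        exact h ⟨k, hk, hc⟩
      refine diam_solutions_eq_zero_of_dense hd hR hℓ hL hB hn hω (δ := 1 / N) (by positivity) ?_
        (dense_of_forall_bin hN₀ h')
      rw [← mul_div_assoc, div_le_iff₀ hℓ] at hN
      rw [one_div, inv_mul_le_iff₀ hN']
      exact hN
  calc ∫ ω, diam (solutions (dissMatrix d fun i => X i ω)) ∂P
      ≤ ∫ ω, (toMeasurable P bad).indicator (fun _ => (1 : ℝ)) ω ∂P :=
        integral_mono_ae (integrable_diam_solutions hcont hX)
          ((integrable_const _).indicator hmeas) hle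
    _ = P.real bad := by
        rw [integral_indicator hmeas]
        simp [measureReal_def]
    _ ≤ N * Real.exp (-(n / N)) := measureReal_exists_empty_bin_le hind hX hN₀

/-- For `N` of order `r` and `n` at least of order `r * log n`, the failure probability is at most
`N / n ^ 2`, which is below the claimed rate. -/
theorem mul_exp_neg_div_le {r n N : ℝ} (hn : 2 ≤ n) (hN : 0 < N) (hNr : N ≤ 9 * r)
    (h : 18 * r * Real.log n ≤ n) : N * Real.exp (-(n / N)) ≤ 18 * (r * (Real.log n / n)) := by
  have hn₀ : 0 < n := by linarith
  have hr : 0 < r := by linarith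
  have hlog : 1 / 2 ≤ Real.log n := by
    linarith [Real.log_two_gt_d9, Real.log_le_log two_pos hn]
  have h₁ : 2 * Real.log n ≤ n / N := by
    rw [le_div_iff₀ hN]
    nlinarith
  have h₂ : Real.exp (-(n / N)) ≤ 1 / n ^ 2 := by
    calc Real.exp (-(n / N)) ≤ Real.exp (-(2 * Real.log n)) := Real.exp_le_exp.2 (by linarith)
      _ = 1 / n ^ 2 := by
        rw [Real.exp_neg, two_mul, Real.exp_add, Real.exp_log hn₀, one_div, sq]
  calc N * Real.exp (-(n / N)) ≤ 9 * r * (1 / n ^ 2) := by gcongr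
    _ = 9 * (r / n) * (1 / n) := by field_simp
    _ ≤ 9 * (r / n) * (2 * Real.log n) := by
        gcongr
        rw [div_le_iff₀ hn₀]
        nlinarith
    _ = 18 * (r * (Real.log n / n)) := by ring

end CircularSeriation

theorem mainTheorem1 :
    ∃ C : ℝ, 0 < C ∧
      ∀ (d : ℝ → ℝ → ℝ) (ℓ L : ℝ),
        CircularSeriation.IsDissimilarity d →
        CircularSeriation.IsContinuousOnCircle d →
        CircularSeriation.IsStrictCircularRobinson d →
        0 < ℓ → ℓ ≤ L →
        CircularSeriation.IsBiLipschitz ℓ L d →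
        ∀ (n : ℕ), 2 ≤ n →
        ∀ {Ω : Type*} [MeasurableSpace Ω] (P : Measure Ω) [IsProbabilityMeasure P]
          (X : Fin n → Ω → ℝ),
          iIndepFun X P →
          (∀ i, HasLaw (X i) CircularSeriation.unif P) →
          Integrable (fun ω => CircularSeriation.diam (CircularSeriation.solutions
            (CircularSeriation.dissMatrix d (fun i => X i ω)))) P ∧
          ∫ ω, CircularSeriation.diam (CircularSeriation.solutions
            (CircularSeriation.dissMatrix d (fun i => X i ω))) ∂P
            ≤ C * (((L + ℓ) / ℓ) * (Real.log n / n)) := by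
  refine ⟨18, by norm_num, ?_⟩
  intro d ℓ L hd hcont hR hℓ hL hB n hn Ω _ P _ X hind hX
  have hint := CircularSeriation.integrable_diam_solutions hcont hX
  refine ⟨hint, ?_⟩
  have hn' : (2 : ℝ) ≤ n := by exact_mod_cast hn
  set r := (L + ℓ) / ℓ with hr
  have hr₂ : 2 ≤ r := by rw [hr, le_div_iff₀ hℓ]; linarith
  rcases le_or_gt (18 * r * Real.log n) n with h | h
  · have hN₀ : 0 < ⌈8 * r⌉₊ := Nat.ceil_pos.2 (by linarith)
    refine (CircularSeriation.integral_diam_le hd hcont hR hℓ hL hB hn hind hX hN₀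
      (Nat.le_ceil _)).trans ?_
    refine CircularSeriation.mul_exp_neg_div_le hn' (by exact_mod_cast hN₀) ?_ h
    linarith [Nat.ceil_lt_add_one (show 0 ≤ 8 * r by linarith)]
  · -- For so few points the right-hand side exceeds `1`.
    have h₁ : ∫ ω, CircularSeriation.diam (CircularSeriation.solutions
        (CircularSeriation.dissMatrix d (fun i => X i ω))) ∂P ≤ ∫ _, (1 : ℝ) ∂P :=
      integral_mono hint (integrable_const _) fun _ => CircularSeriation.diam_le_one _
    refine h₁.trans ?_
    have h₂ : 1 < 18 * r * Real.log n / n := (one_lt_div (by linarith)).2 h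
    calc ∫ _, (1 : ℝ) ∂P = 1 := by simp
      _ ≤ 18 * r * Real.log n / n := h₂.le
      _ = 18 * (r * (Real.log n / n)) := by ring
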